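/- Let $R$ be a complete Noetherian local Cohen–Macaulay ring with an isolated singularity, i.e. $R_{\mathfrak p}$ is a regular local ring for every non-maximal prime $\mathfrak p$. Let $\mathrm{CM}\,R$ be the category of maximal Cohen–Macaulay $R$-modules (finitely generated modules that are zero or have depth $\dim R$), with the short exact sequences of $R$-modules having terms in $\mathrm{CM}\,R$ as its exact sequences. Let $\underline{\mathrm{CM}}\,R$ be its stable category: it has the same objects, and its morphisms are those of $\mathrm{CM}\,R$ modulo the morphisms that factor through a projective object of the exact category $\mathrm{CM}\,R$. Call a sequence $A\to B\to C$ in $\underline{\mathrm{CM}}\,R$ exact if it is isomorphic in $\underline{\mathrm{CM}}\,R$ to the image of an exact sequence $0\to A'\to B'\to C'\to 0$ of $\mathrm{CM}\,R$. In either category, an exact sequence $A\xrightarrow{a}B\xrightarrow{b}C$ is *almost split* if $a$ is left almost split ($a$ is not a split monomorphism, and every morphism from $A$ that is not a split monomorphism factors through $a$) and $b$ is right almost split ($b$ is not a split epimorphism, and every morphism to $C$ that is not a split epimorphism factors through $b$). It is *determined by its terms* if for every exact sequence $A\xrightarrow{a'}B\xrightarrow{b'}C$ with the same terms there are automorphisms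 $g$ of $A$, $f$ of $B$, $h$ of $C$ with $f a'=a g$ and $h b'=b f$. **Theorem.** 1. Each split exact sequence in $\mathrm{CM}\,R$ is determined by its terms. 2. Each almost split sequence in $\mathrm{CM}\,R$ is determined by its terms. 3. Each split exact sequence in $\underline{\mathrm{CM}}\,R$ is determined by its terms. 4. Each almost split sequence in $\underline{\mathrm{CM}}\,R$, and also the image in $\underline{\mathrm{CM}}\,R$ of each almost split sequence of $\mathrm{CM}\,R$, is determined by its terms in $\underline{\mathrm{CM}}\,R$. -/

import Mathlib

open CategoryTheory CategoryTheory.Limits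

universe u

namespace CMRep

section General

variable {C : Type*} [Category* C] [Preadditive C]

/-- Two sequences `A ⟶ B ⟶ C` with the same terms are compared by isomorphisms of short complexes,
i.e. commutative diagrams whose three vertical maps are isomorphisms. Given a class `E` of
"exact sequences", the sequence `S` is determined by its terms if every exact sequence
`S.X₁ ⟶ S.X₂ ⟶ S.X₃` is isomorphic to `S` in this sense. -/
def DeterminedByTerms (E : ShortComplex C → Prop) (S : ShortComplex C) : Prop :=
  ∀ (a' : S.X₁ ⟶ S.X₂) (b' : S.X₂ ⟶ S.X₃) (w : a' ≫ b' = 0),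
    E (ShortComplex.mk a' b' w) → Nonempty (ShortComplex.mk a' b' w ≅ S)

/-- A split exact sequence. -/
structure IsSplitExact (E : ShortComplex C → Prop) (S : ShortComplex C) : Prop where
  exact : E S
  splitting : Nonempty S.Splitting

/-- `b : B ⟶ C` is right almost split: it is not a split epimorphism, and every morphism
`X ⟶ C` which is not a split epimorphism factors through `b`. -/
def IsRightAlmostSplit {B Z : C} (b : B ⟶ Z) : Prop :=
  ¬ IsSplitEpi b ∧ ∀ ⦃X : C⦄ (h : X ⟶ Z), ¬ IsSplitEpi h → ∃ k : X ⟶ B, k ≫ b = h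

/-- `a : A ⟶ B` is left almost split: it is not a split monomorphism, and every morphism
`A ⟶ X` which is not a split monomorphism factors through `a`. -/
def IsLeftAlmostSplit {A B : C} (a : A ⟶ B) : Prop :=
  ¬ IsSplitMono a ∧ ∀ ⦃X : C⦄ (h : A ⟶ X), ¬ IsSplitMono h → ∃ k : B ⟶ X, a ≫ k = h

/-- An almost split sequence (Auslander-Reiten sequence): an exact sequence
`A ⟶ B ⟶ C` whose first map is left almost split and whose second map is right almost split. -/
structure IsAlmostSplit (E : ShortComplex C → Prop) (S : ShortComplex C) : Prop where
  exact : E S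
  left : IsLeftAlmostSplit S.f
  right : IsRightAlmostSplit S.g

/-- A projective object relative to the class `E` of exact sequences: morphisms out of `P` lift
along the second map of each exact sequence. -/
def IsRelProjective (E : ShortComplex C → Prop) (P : C) : Prop :=
  ∀ S : ShortComplex C, E S → ∀ f : P ⟶ S.X₃, ∃ g : P ⟶ S.X₂, g ≫ S.g = f

/-- The morphism `f` factors through a projective object of `(C, E)`. -/
def FactorsThroughProjective (E : ShortComplex C → Prop) {X Y : C} (f : X ⟶ Y) : Prop :=
  ∃ (P : C) (_ : IsRelProjective E P) (g : X ⟶ P) (h : P ⟶ Y), g ≫ h = f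

end General

variable (R : Type u) [CommRing R] [IsLocalRing R]

/-- Maximal Cohen-Macaulay modules over a Noetherian local ring `R`: finitely generated modules
which are zero or have depth equal to `dim R`, i.e. admit a regular sequence in the maximal
ideal of length `dim R` (a longer one never exists). -/
structure IsMaximalCohenMacaulay (M : Type u) [AddCommGroup M] [Module R M] : Prop where
  finite : Module.Finite R M
  depth : Subsingleton M ∨ ∃ rs : List R, (∀ r ∈ rs, r ∈ IsLocalRing.maximalIdeal R) ∧
    RingTheory.Sequence.IsRegular M rs ∧ (rs.length : WithBot ℕ∞) = ringKrullDim R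

/-- Cohen-Macaulay local rings: `depth R = dim R`. -/
def IsCohenMacaulayLocalRing : Prop := IsMaximalCohenMacaulay R R

/-- `R` has (at most) an isolated singularity: its localization at each non-maximal prime ideal
is a regular local ring. -/
def IsIsolatedSingularity : Prop :=
  ∀ (p : Ideal R) [p.IsPrime], p ≠ IsLocalRing.maximalIdeal R →
    IsRegularLocalRing (Localization.AtPrime p)

/-- The property of being maximal Cohen-Macaulay, for objects of the category of `R`-modules. -/
def isMCM : ObjectProperty (ModuleCat.{u} R) := fun M => IsMaximalCohenMacaulay R M

/-- `CM R`, the full subcategory of maximal Cohen-Macaulay modules. -/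
abbrev CM : Type (u + 1) := (isMCM R).FullSubcategory

variable {R}

/-- The exact sequences of the exact category `CM R`: the short exact sequences of `R`-modules
with maximal Cohen-Macaulay terms. -/
def CMExact (S : ShortComplex (CM R)) : Prop := (S.map (isMCM R).ι).ShortExact

theorem isMCM_iff_ext [IsNoetherianRing R] (M : ModuleCat.{u} R) [Module.Finite R M]
    (n : ℕ) (hn : (n : WithBot ℕ∞) = ringKrullDim R) :
    isMCM R M ↔ ∀ i < n, Subsingleton (Abelian.Ext
      (ModuleCat.of R (Shrink.{u} (R ⧸ IsLocalRing.maximalIdeal R))) M i) := by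
  rcases subsingleton_or_nontrivial M with hM | hM
  · have hz : IsZero M := ModuleCat.isZero_of_subsingleton M
    refine ⟨fun _ i _ => subsingleton_of_forall_eq 0 fun x => ?_,
      fun _ => ⟨inferInstance, Or.inl hM⟩⟩
    rw [← Abelian.Ext.comp_mk₀_id x, hz.eq_of_src (𝟙 M) 0, Abelian.Ext.mk₀_zero,
      Abelian.Ext.comp_zero]
  · have hlt : IsLocalRing.maximalIdeal R • (⊤ : Submodule R M) < ⊤ := by
      refine lt_top_iff_ne_top.2 fun h => ?_
      exact (Submodule.top_ne_ideal_smul_of_le_jacobson_annihilator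
        (IsLocalRing.maximalIdeal_le_jacobson _)) h.symm
    have key := (ModuleCat.exists_isRegular_tfae (IsLocalRing.maximalIdeal R) n M hlt).out 1 3
    refine Iff.trans ?_ key.symm
    constructor
    · rintro ⟨_, h | ⟨rs, h1, h2, h3⟩⟩
      · exact (not_subsingleton M h).elim
      · refine ⟨rs, ?_, h1, h2⟩
        rw [← hn] at h3
        exact_mod_cast h3
    · rintro ⟨rs, h1, h2, h3⟩
      exact ⟨inferInstance, Or.inr ⟨rs, h2, h3, by rw [h1, hn]⟩⟩

theorem isMCM_biprod [IsNoetherianRing R] (M N : ModuleCat.{u} R) (hM : isMCM R M)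
    (hN : isMCM R N) : isMCM R (M ⊞ N) := by
  have := hM.finite
  have := hN.finite
  have hfin : Module.Finite R (M ⊞ N : ModuleCat.{u} R) :=
    Module.Finite.equiv (ModuleCat.biprodIsoProd M N).toLinearEquiv.symm
  obtain ⟨n, hn⟩ : ∃ n : ℕ, (n : WithBot ℕ∞) = ringKrullDim R := by
    obtain ⟨d, hd⟩ := WithBot.ne_bot_iff_exists.1 (ringKrullDim_ne_bot (R := R))
    have hd' : d ≠ ⊤ := fun h => ringKrullDim_ne_top (R := R) (by rw [← hd, h]; rfl)
    obtain ⟨n, rfl⟩ := ENat.ne_top_iff_exists.1 hd'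
    exact ⟨n, hd⟩
  rw [isMCM_iff_ext _ n hn] at hM hN ⊢
  intro i hi
  have zero1 := AddCommGrpCat.isZero_of_iff_subsingleton.mpr (hM i hi)
  have zero2 := AddCommGrpCat.isZero_of_iff_subsingleton.mpr (hN i hi)
  have hs : (ShortComplex.mk (biprod.inl : M ⟶ M ⊞ N) (biprod.snd : M ⊞ N ⟶ N)
    (by simp)).ShortExact := (ShortComplex.Splitting.ofHasBinaryBiproduct M N).shortExact
  exact AddCommGrpCat.subsingleton_of_isZero <| ShortComplex.Exact.isZero_of_both_zeros
        (Abelian.Ext.covariant_sequence_exact₂' _ hs i)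
        (zero1.eq_zero_of_src _) (zero2.eq_zero_of_tgt _)

/-- The direct sum in `CM R`. -/
noncomputable def directSum [IsNoetherianRing R] (P Q : CM R) : CM R :=
  ⟨P.obj ⊞ Q.obj, isMCM_biprod _ _ P.property Q.property⟩

theorem factorsThroughProjective_add [IsNoetherianRing R] {X Y : CM R} {f f' : X ⟶ Y}
    (hf : FactorsThroughProjective CMExact f) (hf' : FactorsThroughProjective CMExact f') :
    FactorsThroughProjective CMExact (f + f') := by
  obtain ⟨P, hP, u, v, rfl⟩ := hf
  obtain ⟨Q, hQ, u', v', rfl⟩ := hf'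
  let i : P ⟶ directSum P Q := ObjectProperty.homMk biprod.inl
  let j : Q ⟶ directSum P Q := ObjectProperty.homMk biprod.inr
  let p : directSum P Q ⟶ P := ObjectProperty.homMk biprod.fst
  let q : directSum P Q ⟶ Q := ObjectProperty.homMk biprod.snd
  have hip : i ≫ p = 𝟙 _ := by ext : 1; exact biprod.inl_fst
  have hiq : i ≫ q = 0 := by ext : 1; exact biprod.inl_snd
  have hjp : j ≫ p = 0 := by ext : 1; exact biprod.inr_fst
  have hjq : j ≫ q = 𝟙 _ := by ext : 1; exact biprod.inr_snd
  have htot : p ≫ i + q ≫ j = 𝟙 _ := by ext : 1; exact biprod.total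
  refine ⟨directSum P Q, fun S hS f => ?_, u ≫ i + u' ≫ j, p ≫ v + q ≫ v', ?_⟩
  · obtain ⟨g, hg⟩ := hP S hS (i ≫ f)
    obtain ⟨g', hg'⟩ := hQ S hS (j ≫ f)
    refine ⟨p ≫ g + q ≫ g', ?_⟩
    rw [Preadditive.add_comp, Category.assoc, Category.assoc, hg, hg', ← Category.assoc,
      ← Category.assoc, ← Preadditive.add_comp, htot, Category.id_comp]
  · simp [reassoc_of% hip, reassoc_of% hiq, reassoc_of% hjp, reassoc_of% hjq]

theorem factorsThroughProjective_zero {X Y : CM R} :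
    FactorsThroughProjective CMExact (0 : X ⟶ Y) := by
  let Z : CM R := ⟨ModuleCat.of R PUnit, ⟨inferInstance, Or.inl inferInstance⟩⟩
  refine ⟨Z, fun S _ f => ⟨0, ?_⟩, 0, 0, by simp⟩
  ext x
  have hx : x = 0 := Subsingleton.elim (α := PUnit) _ _
  subst hx
  simp

theorem factorsThroughProjective_neg {X Y : CM R} {f : X ⟶ Y}
    (hf : FactorsThroughProjective CMExact f) : FactorsThroughProjective CMExact (-f) := by
  obtain ⟨P, hP, u, v, rfl⟩ := hf
  exact ⟨P, hP, u, -v, by simp⟩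

variable (R)

/-- Two parallel morphisms of `CM R` are identified in the stable category when their
difference factors through a projective object of `CM R`. -/
def stableRel : HomRel (CM R) := fun _ _ f g => FactorsThroughProjective CMExact (f - g)

instance [IsNoetherianRing R] : Congruence (stableRel R) where
  comp_left := by
    rintro X Y Z f g g' ⟨P, hP, u, v, h⟩
    exact ⟨P, hP, f ≫ u, v, by rw [Category.assoc, h, Preadditive.comp_sub]⟩
  comp_right := by
    rintro X Y Z f f' g ⟨P, hP, u, v, h⟩
    exact ⟨P, hP, u, v ≫ g, by rw [← Category.assoc, h, Preadditive.sub_comp]⟩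
  equivalence :=
    { refl := fun f => by
        simpa [stableRel] using factorsThroughProjective_zero
      symm := fun {f g} h => by
        simpa [stableRel] using factorsThroughProjective_neg h
      trans := fun {f g k} h h' => by
        simpa [stableRel] using factorsThroughProjective_add h h' }

theorem stableRel_add [IsNoetherianRing R] ⦃X Y : CM R⦄ (f₁ f₂ g₁ g₂ : X ⟶ Y)
    (hf : stableRel R f₁ f₂) (hg : stableRel R g₁ g₂) : stableRel R (f₁ + g₁) (f₂ + g₂) := by
  have h := factorsThroughProjective_add hf hg
  rwa [show f₁ - f₂ + (g₁ - g₂) = f₁ + g₁ - (f₂ + g₂) by abel] at h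

/-- The stable category of `CM R`: the same objects, and as morphisms the morphisms of `CM R`
modulo those factoring through projective objects. -/
abbrev StableCM : Type (u + 1) := Quotient (stableRel R)

noncomputable instance [IsNoetherianRing R] : Preadditive (StableCM R) :=
  Quotient.preadditive (stableRel R) (stableRel_add R)

/-- The canonical functor from `CM R` to its stable category. -/
abbrev toStable : CM R ⥤ StableCM R := Quotient.functor (stableRel R)

instance [IsNoetherianRing R] : (toStable R).Additive :=
  Quotient.functor_additive (stableRel R) (stableRel_add R)

variable {R}

/-- The exact sequences of the stable category: those sequences `A ⟶ B ⟶ C` which are isomorphic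
(in the stable category) to the image of an exact sequence of `CM R`. -/
def StableExact [IsNoetherianRing R] (S : ShortComplex (StableCM R)) : Prop :=
  ∃ T : ShortComplex (CM R), CMExact T ∧ Nonempty (T.map (toStable R) ≅ S)

end CMRep

/-!
The theorem is proved by comparing lengths, as in Miyata's theorem that a short exact sequence `0
→ A → A ⊕ C → C → 0` of finitely generated modules splits.

For a short exact sequence `0 → X → Y → Z → 0` in `CM R` and a module `N` of finite length,
consider the cokernel of `Hom(Y, N) → Hom(X, N)`, called the extension defect. Its length is
determined by the terms, even up to stable isomorphism (`length_extensionDefect_eq`): stably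
isomorphic modules become isomorphic after adding free modules, and the error terms cancel because
lengths at a minimal prime ideal are additive in exact sequences. Moreover, a map between finitely
generated modules extends along another one as soon as it does so modulo all powers of the maximal
ideal (`exists_comp_eq_of_forall_pow`), so the defects with coefficients of finite length control
the extension problem. In particular the sequence splits iff all its defects vanish, which settles
the split exact sequences; in the stable category one uses that a sequence whose second map is
stably a split epimorphism is split.

Now let `T` be almost split and `S` exact with the same terms. Then `S` does not split, so its
second map factors through that of `T`, and there is a morphism `F : S ⟶ T` with `F.τ₃` an
isomorphism. It induces an injection from the defect of `T` to that of `S`; as both have the same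
length, it is bijective. Passing to the limit over the powers of the maximal ideal gives `φ : T.X₁
⟶ S.X₁` such that `1 - φ ≫ F.τ₁` extends along `T.f` (`CMExact.exists_of_hom`). Since `T.f` is
left almost split, `φ ≫ F.τ₁` is invertible (`IsLeftAlmostSplit.isIso_of_comp_eq_id_sub`). So
`F.τ₁` is a split epimorphism between isomorphic objects, hence an isomorphism because
endomorphism rings are Noetherian, and `F` is an isomorphism. The argument in the stable category
is the same (`nonempty_iso_map_toStable`), with `F.τ₃` only a stable isomorphism. There the five
lemma is replaced by an explicit stable section of `F.τ₂`.
-/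

universe v

namespace CMRep

/-! ### Linear systems, extension defects and lengths -/

section Modules

theorem mem_smul_top_of_forall_mem {R ι N : Type*} [CommRing R] [Finite ι] [AddCommGroup N]
    [Module R N] (I : Ideal R) {z : ι → N} (hz : ∀ j, z j ∈ I • (⊤ : Submodule R N)) :
    z ∈ I • (⊤ : Submodule R (ι → N)) := by
  classical
  have := Fintype.ofFinite ι
  rw [← Finset.univ_sum_single z]
  refine Submodule.sum_mem _ fun j _ => ?_
  have h := Submodule.mem_map_of_mem (f := LinearMap.single R (fun _ : ι => N) j) (hz j)
  rw [Submodule.map_smul''] at h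
  exact Submodule.smul_mono le_rfl le_top h

variable {R : Type u} [CommRing R]

/-- Extending `g : A → N` along `f : A → B` amounts to solving a finite system of linear equations
in `N`, since `B` is finitely presented. By Krull's intersection theorem, applied to the cokernel of
the system, such a system is solvable in `N` if it is solvable modulo each power of the maximal
ideal. -/
theorem exists_comp_eq_of_forall_pow [IsLocalRing R] [IsNoetherianRing R] {A B N : Type*}
    [AddCommGroup A] [Module R A] [Module.Finite R A] [AddCommGroup B] [Module R B]
    [Module.Finite R B] [AddCommGroup N] [Module R N] [Module.Finite R N]
    (f : A →ₗ[R] B) (g : A →ₗ[R] N)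
    (h : ∀ n : ℕ, ∃ k : B →ₗ[R] N ⧸ (IsLocalRing.maximalIdeal R ^ n • (⊤ : Submodule R N)),
      k ∘ₗ f = Submodule.mkQ _ ∘ₗ g) :
    ∃ k : B →ₗ[R] N, k ∘ₗ f = g := by
  classical
  -- `ρ` gives relations presenting `B`, and `σ` lifts the images in `B` of generators of `A`. A
  -- family `x` in `N` solves `T x = y` iff it kills the relations and takes the values of `g`.
  obtain ⟨b, π, hπ⟩ := Module.Finite.exists_fin' R B
  obtain ⟨c, ρ, hρ⟩ := Module.Finite.exists_fin' R (LinearMap.ker π)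
  obtain ⟨s, p, hp⟩ := Module.Finite.exists_fin' R A
  choose σ hσ using fun j : Fin s => hπ (f (p (Pi.single j 1)))
  let v : Fin c ⊕ Fin s → Fin b → R := Sum.elim (fun j => (ρ (Pi.single j 1) : Fin b → R)) σ
  let T : (Fin b → N) →ₗ[R] (Fin c ⊕ Fin s → N) :=
    LinearMap.pi fun j => ∑ i, v j i • LinearMap.proj i
  have hT (x : Fin b → N) (j) : T x j = Fintype.linearCombination R x (v j) := by
    simp [T, Fintype.linearCombination_apply]
  let y : Fin c ⊕ Fin s → N := Sum.elim 0 fun j => g (p (Pi.single j 1))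
  have hy : y ∈ LinearMap.range T := by
    rw [← Submodule.Quotient.mk_eq_zero, ← Submodule.mem_bot R,
      ← Ideal.iInf_pow_smul_eq_bot_of_isLocalRing (IsLocalRing.maximalIdeal R)
        (Ideal.IsPrime.ne_top inferInstance), Submodule.mem_iInf]
    intro n
    obtain ⟨k, hk⟩ := h n
    choose x hx using fun i : Fin b => Submodule.mkQ_surjective _ (k (π (Pi.single i 1)))
    have hkx : Submodule.mkQ _ ∘ₗ Fintype.linearCombination R x = k ∘ₗ π := by
      refine LinearMap.pi_ext' fun i => LinearMap.ext_ring ?_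
      simpa [Fintype.linearCombination_apply_single] using hx i
    have hyx : y - T x ∈ IsLocalRing.maximalIdeal R ^ n • (⊤ : Submodule R _) := by
      refine mem_smul_top_of_forall_mem _ fun j => ?_
      rw [← Submodule.Quotient.mk_eq_zero, ← Submodule.mkQ_apply, Pi.sub_apply, map_sub, hT,
        ← LinearMap.comp_apply (Submodule.mkQ _) (Fintype.linearCombination R x), hkx]
      rcases j with j | j
      · have h0 := (ρ (Pi.single j 1)).2
        rw [LinearMap.mem_ker] at h0
        simp [y, v, h0]
      · have h0 := LinearMap.congr_fun hk (p (Pi.single j 1))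
        rw [LinearMap.comp_apply, LinearMap.comp_apply] at h0
        simp only [y, v, Sum.elim_inr, LinearMap.comp_apply, hσ, h0, sub_self]
    have hq := Submodule.mem_map_of_mem (f := (LinearMap.range T).mkQ) hyx
    rw [Submodule.map_smul'', map_sub, Submodule.mkQ_apply, Submodule.mkQ_apply,
      (Submodule.Quotient.mk_eq_zero _).2 (LinearMap.mem_range_self T x), sub_zero] at hq
    exact Submodule.smul_mono le_rfl le_top hq
  obtain ⟨x, hx⟩ := hy
  have hker : LinearMap.ker π ≤ LinearMap.ker (Fintype.linearCombination R x) := by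
    have h0 : Fintype.linearCombination R x ∘ₗ (LinearMap.ker π).subtype ∘ₗ ρ = 0 := by
      refine LinearMap.pi_ext' fun j => LinearMap.ext_ring ?_
      simpa [hT, v, y] using congrFun hx (Sum.inl j)
    intro z hz
    obtain ⟨t, ht⟩ := hρ ⟨z, hz⟩
    simpa [ht] using LinearMap.congr_fun h0 t
  refine ⟨(LinearMap.ker π).liftQ _ hker ∘ₗ (π.quotKerEquivOfSurjective hπ).symm, ?_⟩
  have hk (z) : ((LinearMap.ker π).liftQ _ hker ∘ₗ
      (π.quotKerEquivOfSurjective hπ).symm.toLinearMap) (π z) =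
        Fintype.linearCombination R x z := by
    have : (π.quotKerEquivOfSurjective hπ).symm (π z) = Submodule.Quotient.mk z := by
      rw [LinearEquiv.symm_apply_eq]; rfl
    simp [this]
  rw [← LinearMap.cancel_right hp]
  refine LinearMap.pi_ext' fun j => LinearMap.ext_ring ?_
  have h1 := congrFun hx (Sum.inr j)
  rw [hT] at h1
  simp only [LinearMap.comp_apply, LinearMap.single_apply]
  rw [← hσ j]
  exact (hk _).trans h1

theorem isFiniteLength_quotient_pow_smul_top [IsLocalRing R] [IsNoetherianRing R] (M : Type*)
    [AddCommGroup M] [Module R M] [Module.Finite R M] (n : ℕ) :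
    IsFiniteLength R (M ⧸ (IsLocalRing.maximalIdeal R ^ n • (⊤ : Submodule R M))) := by
  have : Ring.KrullDimLE 0 (R ⧸ IsLocalRing.maximalIdeal R ^ n) := by
    refine Ideal.krullDimLE_zero_quotient_iff_forall_minimalPrimes_isMaximal.2 fun J hJ => ?_
    have := hJ.1.1
    rw [← IsLocalRing.maximalIdeal.isMaximal R |>.eq_of_le this.ne_top
      (Ideal.IsPrime.le_of_pow_le hJ.1.2)]
    infer_instance
  have : IsArtinianRing (R ⧸ IsLocalRing.maximalIdeal R ^ n) :=
    IsNoetherianRing.isArtinianRing_of_krullDimLE_zero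
  have : Module.Finite (R ⧸ IsLocalRing.maximalIdeal R ^ n)
      (M ⧸ (IsLocalRing.maximalIdeal R ^ n • (⊤ : Submodule R M))) :=
    Module.Finite.of_restrictScalars_finite R _ _
  exact isFiniteLength_iff_isNoetherian_isArtinian.2 ⟨inferInstance,
    isArtinian_of_surjective_algebraMap (R := R ⧸ IsLocalRing.maximalIdeal R ^ n)
      Ideal.Quotient.mk_surjective⟩

theorem isFiniteLength_linearMap (M N : Type*) [AddCommGroup M] [Module R M] [Module.Finite R M]
    [AddCommGroup N] [Module R N] (hN : IsFiniteLength R N) : IsFiniteLength R (M →ₗ[R] N) := by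
  obtain ⟨b, π, hπ⟩ := Module.Finite.exists_fin' R M
  have hpi : IsFiniteLength R (Fin b → N) := by
    rw [isFiniteLength_iff_isNoetherian_isArtinian] at hN ⊢
    obtain ⟨_, _⟩ := hN
    exact ⟨inferInstance, inferInstance⟩
  refine hpi.of_injective (f := LinearMap.pi fun i => LinearMap.applyₗ (π (Pi.single i 1)))
    fun k l hkl => ?_
  rw [← LinearMap.cancel_right hπ]
  refine LinearMap.pi_ext' fun j => LinearMap.ext_ring ?_
  simpa using congrFun hkl j

section Defect

variable {X Y Z N : Type*} [AddCommGroup X] [Module R X] [AddCommGroup Y] [Module R Y]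
  [AddCommGroup Z] [Module R Z] [AddCommGroup N] [Module R N]

/-- The module of maps `X → N` modulo those which extend along `f : X → Y`. -/
abbrev ExtensionDefect (f : X →ₗ[R] Y) (N : Type*) [AddCommGroup N] [Module R N] : Type _ :=
  (X →ₗ[R] N) ⧸ LinearMap.range (LinearMap.lcomp R N f)

theorem length_linearMap_add_length_linearMap (f : X →ₗ[R] Y) (g : Y →ₗ[R] Z)
    (hfg : Function.Exact f g) (hg : Function.Surjective g) :
    Module.length R (X →ₗ[R] N) + Module.length R (Z →ₗ[R] N) =
      Module.length R (Y →ₗ[R] N) + Module.length R (ExtensionDefect f N) := by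
  have h1 := Module.length_eq_add_of_exact (LinearMap.range (LinearMap.lcomp R N f)).subtype
    (Submodule.mkQ _) (Submodule.subtype_injective _) (Submodule.mkQ_surjective _)
    (LinearMap.exact_subtype_mkQ _)
  have h2 := Module.length_eq_add_of_exact (LinearMap.lcomp R N g)
    (LinearMap.lcomp R N f).rangeRestrict
    (fun a b hab => (LinearMap.cancel_right hg).1 hab) (LinearMap.surjective_rangeRestrict _) (by
      intro φ
      rw [← LinearMap.mem_ker, LinearMap.ker_rangeRestrict, LinearMap.mem_ker]
      exact (LinearMap.exact_lcomp_of_exact_of_surjective hfg hg (N := N)) φ)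
  rw [h1, h2]
  abel

end Defect

/-- The length of the localization of a module at a submonoid of the base ring, as a module over the
localized ring. At a minimal prime ideal this is finite and serves as a rank. -/
noncomputable def localLength (S : Submonoid R) (X : Type*) [AddCommGroup X] [Module R X] : ℕ∞ :=
  Module.length (Localization S) (LocalizedModule S X)

theorem localLength_eq_add_of_exact (S : Submonoid R) {X Y Z : Type*} [AddCommGroup X] [Module R X]
    [AddCommGroup Y] [Module R Y] [AddCommGroup Z] [Module R Z] (f : X →ₗ[R] Y) (g : Y →ₗ[R] Z)
    (hf : Function.Injective f) (hfg : Function.Exact f g) (hg : Function.Surjective g) :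
    localLength S Y = localLength S X + localLength S Z :=
  Module.length_eq_add_of_exact (LocalizedModule.map S f) (LocalizedModule.map S g)
    (LocalizedModule.map_injective S f hf) (LocalizedModule.map_surjective S g hg)
    (LocalizedModule.map_exact S f g hfg)

theorem localLength_congr (S : Submonoid R) {X Y : Type*} [AddCommGroup X] [Module R X]
    [AddCommGroup Y] [Module R Y] (e : X ≃ₗ[R] Y) : localLength S X = localLength S Y :=
  le_antisymm
    (Module.length_le_of_injective _ (LocalizedModule.map_injective S e.toLinearMap e.injective))
    (Module.length_le_of_surjective _
      (LocalizedModule.map_surjective S e.toLinearMap e.surjective))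

theorem localLength_pi (S : Submonoid R) (p : ℕ) :
    localLength S (Fin p → R) = p * localLength S R := by
  induction p with
  | zero => simp [localLength]
  | succ p ih =>
    rw [localLength_eq_add_of_exact S (LinearMap.single R (fun _ : Fin (p + 1) => R) 0)
      (LinearMap.funLeft R R Fin.succ) (fun a b h => by simpa using congrFun h 0) ?_ ?_, ih]
    · push_cast; ring
    · intro x
      constructor
      · intro h
        refine ⟨x 0, ?_⟩
        ext i
        refine Fin.cases (by simp) (fun j => ?_) i
        simpa using (congrFun h j).symm
      · rintro ⟨y, rfl⟩
        ext j
        simp [LinearMap.funLeft]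
    · exact LinearMap.funLeft_surjective_of_injective _ _ _ (Fin.succ_injective p)

theorem localLength_ne_top [IsNoetherianRing R] {q : Ideal R} (hq : q ∈ minimalPrimes R)
    [q.IsPrime] (X : Type*) [AddCommGroup X] [Module R X] [Module.Finite R X] :
    localLength q.primeCompl X ≠ ⊤ := by
  have : Ring.KrullDimLE 0 (Localization.AtPrime q) := .of_isLocalization q hq _
  have : IsNoetherianRing (Localization.AtPrime q) :=
    IsLocalization.isNoetherianRing q.primeCompl _ inferInstance
  have : IsArtinianRing (Localization.AtPrime q) :=
    IsNoetherianRing.isArtinianRing_of_krullDimLE_zero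
  exact Module.length_ne_top

theorem localLength_self_ne_zero {q : Ideal R} [q.IsPrime] : localLength q.primeCompl R ≠ 0 := by
  rw [localLength, Ne, Module.length_eq_zero_iff, not_subsingleton_iff_nontrivial]
  exact (inferInstance : Nontrivial (Localization.AtPrime q))

/-- Two modules are stably equivalent if they become isomorphic after adding to each of them
a free module of finite rank. -/
def StablyEquivalent (R : Type*) [CommRing R] (X X' : Type*) [AddCommGroup X] [Module R X]
    [AddCommGroup X'] [Module R X'] : Prop :=
  ∃ p p' : ℕ, Nonempty ((X × (Fin p → R)) ≃ₗ[R] (X' × (Fin p' → R)))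

theorem StablyEquivalent.length {X X' : Type v} [AddCommGroup X] [Module R X]
    [AddCommGroup X'] [Module R X'] (h : StablyEquivalent R X X') (N : Type*) [AddCommGroup N]
    [Module R N] (S : Submonoid R) :
    ∃ p p' : ℕ,
      Module.length R (X →ₗ[R] N) + p * Module.length R N =
          Module.length R (X' →ₗ[R] N) + p' * Module.length R N ∧
      localLength S X + p * localLength S R = localLength S X' + p' * localLength S R := by
  obtain ⟨p, p', ⟨e⟩⟩ := h
  refine ⟨p, p', ?_, ?_⟩
  · have key (W : Type v) [AddCommGroup W] [Module R W] (p : ℕ) :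
        Module.length R ((W × (Fin p → R)) →ₗ[R] N) =
          Module.length R (W →ₗ[R] N) + p * Module.length R N := by
      rw [← (LinearMap.coprodEquiv R).length_eq, Module.length_prod,
        (LinearEquiv.piRing R N (Fin p) R).length_eq, Module.length_pi]
      simp
    rw [← key, ← key]
    exact (LinearEquiv.congrLeft N R e).length_eq
  · have key (W : Type v) [AddCommGroup W] [Module R W] (p : ℕ) :
        localLength S (W × (Fin p → R)) = localLength S W + p * localLength S R := by
      rw [← localLength_pi]
      exact localLength_eq_add_of_exact S _ _ LinearMap.inl_injective .inl_snd
        LinearMap.snd_surjective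
    rw [← key, ← key]
    exact localLength_congr S e

/-- By additivity of length, the length of the extension defect is that of `Hom(X, N)`, minus
`Hom(Y, N)`, plus `Hom(Z, N)`. Replacing the terms by stably equivalent modules therefore changes it
by a multiple of the length of `N`, and the multiplicity is the alternating sum of the numbers of
free summands involved. That sum vanishes, because lengths at a minimal prime ideal are additive
too. -/
theorem length_extensionDefect_eq [IsNoetherianRing R] [Nontrivial R]
    {X Y Z X' Y' Z' N : Type v}
    [AddCommGroup X] [Module R X] [AddCommGroup Y] [Module R Y] [AddCommGroup Z] [Module R Z]
    [AddCommGroup X'] [Module R X'] [AddCommGroup Y'] [Module R Y'] [AddCommGroup Z'] [Module R Z']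
    [AddCommGroup N] [Module R N]
    [Module.Finite R X] [Module.Finite R Y] [Module.Finite R Z]
    [Module.Finite R X'] [Module.Finite R Y'] [Module.Finite R Z']
    (hN : IsFiniteLength R N)
    {f : X →ₗ[R] Y} {g : Y →ₗ[R] Z} {f' : X' →ₗ[R] Y'} {g' : Y' →ₗ[R] Z'}
    (hf : Function.Injective f) (hfg : Function.Exact f g) (hg : Function.Surjective g)
    (hf' : Function.Injective f') (hfg' : Function.Exact f' g') (hg' : Function.Surjective g')
    (hX : StablyEquivalent R X X') (hY : StablyEquivalent R Y Y') (hZ : StablyEquivalent R Z Z') :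
    Module.length R (ExtensionDefect f N) = Module.length R (ExtensionDefect f' N) := by
  obtain ⟨q, hq⟩ : (minimalPrimes R).Nonempty :=
    Set.nonempty_coe_sort.1 (Ideal.nonempty_minimalPrimes bot_ne_top)
  have : q.IsPrime := hq.1.1
  have hHom (W : Type v) [AddCommGroup W] [Module R W] [Module.Finite R W] :
      Module.length R (W →ₗ[R] N) ≠ ⊤ :=
    Module.length_ne_top_iff.2 (isFiniteLength_linearMap W N hN)
  have hD {W V : Type v} [AddCommGroup W] [Module R W] [AddCommGroup V] [Module R V]
      [Module.Finite R W] (f : W →ₗ[R] V) : Module.length R (ExtensionDefect f N) ≠ ⊤ :=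
    Module.length_ne_top_iff.2
      ((isFiniteLength_linearMap W N hN).of_surjective (Submodule.mkQ_surjective _))
  obtain ⟨px, px', hx, rx⟩ := hX.length N q.primeCompl
  obtain ⟨py, py', hy, ry⟩ := hY.length N q.primeCompl
  obtain ⟨pz, pz', hz, rz⟩ := hZ.length N q.primeCompl
  have h := length_linearMap_add_length_linearMap (N := N) f g hfg hg
  have h' := length_linearMap_add_length_linearMap (N := N) f' g' hfg' hg'
  have r := localLength_eq_add_of_exact q.primeCompl f g hf hfg hg
  have r' := localLength_eq_add_of_exact q.primeCompl f' g' hf' hfg' hg'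
  have r0 : localLength q.primeCompl R ≠ 0 := localLength_self_ne_zero
  have hN' := Module.length_ne_top_iff.2 hN
  generalize hδ : Module.length R (ExtensionDefect f N) = δ at *
  generalize hδ' : Module.length R (ExtensionDefect f' N) = δ' at *
  lift δ to ℕ using hδ ▸ hD f
  lift δ' to ℕ using hδ' ▸ hD f'
  lift Module.length R N to ℕ using hN' with n
  lift Module.length R (X →ₗ[R] N) to ℕ using hHom X with a₁
  lift Module.length R (Y →ₗ[R] N) to ℕ using hHom Y with a₂
  lift Module.length R (Z →ₗ[R] N) to ℕ using hHom Z with a₃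
  lift Module.length R (X' →ₗ[R] N) to ℕ using hHom X' with b₁
  lift Module.length R (Y' →ₗ[R] N) to ℕ using hHom Y' with b₂
  lift Module.length R (Z' →ₗ[R] N) to ℕ using hHom Z' with b₃
  lift localLength q.primeCompl R to ℕ using localLength_ne_top hq R with m
  lift localLength q.primeCompl X to ℕ using localLength_ne_top hq X with c₁
  lift localLength q.primeCompl Y to ℕ using localLength_ne_top hq Y with c₂
  lift localLength q.primeCompl Z to ℕ using localLength_ne_top hq Z with c₃
  lift localLength q.primeCompl X' to ℕ using localLength_ne_top hq X' with d₁
  lift localLength q.primeCompl Y' to ℕ using localLength_ne_top hq Y' with d₂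
  lift localLength q.primeCompl Z' to ℕ using localLength_ne_top hq Z' with d₃
  norm_cast at *
  zify at *
  -- Multiplying by the length of `R` at `q` turns the rank equations into the vanishing of the
  -- coefficient of the length of `N`.
  refine mul_left_cancel₀ r0 ?_
  linear_combination m * (h' - h) + m * (hx + hz - hy) - n * (rx + rz - ry) - n * (r - r')

end Modules

/-! ### Projective objects and stable isomorphisms -/

section Stable

/-- Maps `f` and `f'` that are mutually inverse up to maps through projective modules exhibit `X` as
a direct summand of `X' × P`, and the complement `K` is projective: the projection onto it
factors through `P' × P × P`. -/
theorem StablyEquivalent.of_factorization {R : Type u} [CommRing R] [IsLocalRing R]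
    {X X' P P' : Type v} [AddCommGroup X] [Module R X] [AddCommGroup X'] [Module R X']
    [AddCommGroup P] [Module R P] [AddCommGroup P'] [Module R P']
    [Module.Finite R X'] [Module.Finite R P]
    [Module.Projective R P] [Module.Projective R P']
    (f : X →ₗ[R] X') (f' : X' →ₗ[R] X) (u : X →ₗ[R] P) (v : P →ₗ[R] X)
    (u' : X' →ₗ[R] P') (v' : P' →ₗ[R] X')
    (h : ∀ x, f' (f x) = x + v (u x)) (h' : ∀ x, f (f' x) = x + v' (u' x)) :
    StablyEquivalent R X X' := by
  let i : X →ₗ[R] X' × P := f.prod u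
  let ρ : X' × P →ₗ[R] X := f'.coprod (-v)
  have hρi : ρ ∘ₗ i = LinearMap.id := by
    ext x
    simp [ρ, i, h]
  let K := LinearMap.ker ρ
  have hK : Function.Exact K.subtype ρ := LinearMap.exact_subtype_ker_map ρ
  let e : (X' × P) ≃ₗ[R] K × X :=
    (hK.splitSurjectiveEquiv K.injective_subtype ⟨i, hρi⟩).1
  have : Module.Finite R K :=
    Module.Finite.of_surjective (LinearMap.fst R K X ∘ₗ e.toLinearMap)
      (Prod.fst_surjective.comp e.surjective)
  have : Module.Projective R K := by
    -- The projection `1 - i ρ` sends `(x', p)` to `(-v' u' x' + f v p, p - u f' x' + u v p)`;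
    -- `β ∘ α` is this formula, read through `(u' x', p, u f' x')`.
    let α : K →ₗ[R] P' × P × P :=
      ((u' ∘ₗ LinearMap.fst R X' P).prod
        ((LinearMap.snd R X' P).prod (u ∘ₗ f' ∘ₗ LinearMap.fst R X' P))) ∘ₗ K.subtype
    let β : P' × P × P →ₗ[R] X' × P :=
      LinearMap.coprod ((-v').prod 0) (LinearMap.coprod
        ((f ∘ₗ v).prod (LinearMap.id + u ∘ₗ v)) (LinearMap.prod 0 (-LinearMap.id)))
    let s : P' × P × P →ₗ[R] K := ((LinearMap.id - i ∘ₗ ρ) ∘ₗ β).codRestrict K fun z => by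
      have := LinearMap.congr_fun hρi (ρ (β z))
      rw [LinearMap.comp_apply, LinearMap.id_apply] at this
      simp [K, this]
    refine Module.Projective.of_split α s (LinearMap.ext fun k => Subtype.ext ?_)
    have hk : ρ k.1 = 0 := k.2
    have hk' : f' k.1.1 = v k.1.2 := by
      rw [← sub_eq_zero, sub_eq_add_neg]
      exact hk
    have hβ : β (α k) = k.1 := by
      have h1 := h' k.1.1
      have h2 := congrArg f hk'
      have h3 := congrArg u hk'
      refine Prod.ext ?_ ?_
      · simp [α, β]
        rw [← h2, h1]; abel
      · simp [α, β]
        rw [h3]; abel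
    change β (α k) - i (ρ (β (α k))) = k.1
    rw [hβ, hk, map_zero, sub_zero]
  have : Module.Free R K := Module.free_of_flat_of_isLocalRing
  have : Module.Free R P := Module.free_of_flat_of_isLocalRing
  exact ⟨_, _, ⟨((LinearEquiv.refl R X).prodCongr (Module.finBasis R K).equivFun.symm).trans <|
    (LinearEquiv.prodComm R X K).trans <| e.symm.trans <|
    (LinearEquiv.refl R X').prodCongr (Module.finBasis R P).equivFun⟩⟩

variable {R : Type u} [CommRing R] [IsLocalRing R]

theorem IsMaximalCohenMacaulay.of_linearEquiv {M N : Type u} [AddCommGroup M] [Module R M]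
    [AddCommGroup N] [Module R N] (hM : IsMaximalCohenMacaulay R M) (e : M ≃ₗ[R] N) :
    IsMaximalCohenMacaulay R N := by
  have := hM.finite
  refine ⟨Module.Finite.equiv e, hM.depth.imp
    (fun (_ : Subsingleton M) => e.symm.injective.subsingleton) ?_⟩
  rintro ⟨rs, h1, h2, h3⟩
  exact ⟨rs, h1, (e.isRegular_congr rs).1 h2, h3⟩

variable [IsNoetherianRing R]

theorem isMCM_pi (hCM : IsCohenMacaulayLocalRing R) (n : ℕ) :
    isMCM R (ModuleCat.of R (Fin n → R)) := by
  induction n with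
  | zero => exact ⟨inferInstance, Or.inl inferInstance⟩
  | succ n ih =>
    refine (isMCM_biprod (ModuleCat.of R R) _ hCM ih).of_linearEquiv
      ((ModuleCat.biprodIsoProd _ _).toLinearEquiv.trans (Fin.consLinearEquiv R fun _ => R))

/-- The kernel of a surjection between maximal Cohen-Macaulay modules is maximal
Cohen-Macaulay: by the long exact sequence, its `Ext` groups from the residue field vanish in
degrees less than `dim R`. -/
theorem isMCM_X₁ {S : ShortComplex (ModuleCat.{u} R)} (hS : S.ShortExact) (h₂ : isMCM R S.X₂)
    (h₃ : isMCM R S.X₃) : isMCM R S.X₁ := by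
  have := h₂.finite
  have := h₃.finite
  have := hS.mono_f
  have : Module.Finite R S.X₁ :=
    Module.Finite.of_injective S.f.hom ((ModuleCat.mono_iff_injective _).1 inferInstance)
  obtain ⟨n, hn⟩ : ∃ n : ℕ, (n : WithBot ℕ∞) = ringKrullDim R := by
    obtain ⟨d, hd⟩ := WithBot.ne_bot_iff_exists.1 (ringKrullDim_ne_bot (R := R))
    have hd' : d ≠ ⊤ := fun h => ringKrullDim_ne_top (R := R) (by rw [← hd, h]; rfl)
    obtain ⟨n, rfl⟩ := ENat.ne_top_iff_exists.1 hd'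
    exact ⟨n, hd⟩
  rw [isMCM_iff_ext _ n hn] at h₂ h₃ ⊢
  intro i hi
  refine subsingleton_of_forall_eq 0 fun x => ?_
  have hx := (h₂ i hi).elim (x.comp (Abelian.Ext.mk₀ S.f) (add_zero i)) 0
  rcases i with _ | i
  · obtain ⟨y, rfl⟩ := (Abelian.Ext.mk₀_bijective _ _).2 x
    rw [Abelian.Ext.mk₀_comp_mk₀, Abelian.Ext.mk₀_eq_zero_iff] at hx
    rw [Abelian.Ext.mk₀_eq_zero_iff]
    exact zero_of_comp_mono _ hx
  · obtain ⟨y, rfl⟩ := Abelian.Ext.covariant_sequence_exact₁ _ hS x hx rfl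
    rw [(h₃ i (by omega)).elim y 0, Abelian.Ext.zero_comp]

/-- Over a Cohen-Macaulay local ring, a projective object of the exact category `CM R` is a
projective module: it is a quotient of a free module of finite rank, which lies in `CM R` together
with the kernel of the quotient map. -/
theorem IsRelProjective.projective (hCM : IsCohenMacaulayLocalRing R) {P : CM R}
    (hP : IsRelProjective CMExact P) : Module.Projective R P.obj := by
  have := P.property.finite
  obtain ⟨n, π, hπ⟩ := Module.Finite.exists_fin' R P.obj
  let S : ShortComplex (ModuleCat.{u} R) :=
    .mk (ModuleCat.ofHom (LinearMap.ker π).subtype) (ModuleCat.ofHom π) (by ext x; exact x.2)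
  have hS : S.ShortExact :=
    { exact := (ShortComplex.ShortExact.moduleCat_exact_iff_function_exact S).2
        (LinearMap.exact_subtype_ker_map π)
      mono_f := (ModuleCat.mono_iff_injective _).2 (Submodule.injective_subtype _)
      epi_g := (ModuleCat.epi_iff_surjective _).2 hπ }
  let F : CM R := ⟨ModuleCat.of R (Fin n → R), isMCM_pi hCM n⟩
  let K : CM R := ⟨S.X₁, isMCM_X₁ hS F.property P.property⟩
  let T : ShortComplex (CM R) := .mk (X₁ := K) (X₂ := F) (X₃ := P)
    (ObjectProperty.homMk S.f) (ObjectProperty.homMk S.g)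
    (by ext : 1; exact S.zero)
  obtain ⟨s, hs⟩ := hP T hS (𝟙 P)
  refine Module.Projective.of_split s.hom.hom π ?_
  have := congrArg (fun f => f.hom.hom) hs
  exact this

theorem factorsThroughProjective_of_map_eq {X Y : CM R} {f g : X ⟶ Y}
    (h : (toStable R).map f = (toStable R).map g) :
    FactorsThroughProjective CMExact (f - g) :=
  (Quotient.functor_map_eq_iff (stableRel R) f g).1 h

theorem map_eq_of_factorsThroughProjective {X Y : CM R} {f g : X ⟶ Y}
    (h : FactorsThroughProjective CMExact (f - g)) :
    (toStable R).map f = (toStable R).map g :=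
  (Quotient.functor_map_eq_iff (stableRel R) f g).2 h

/-- Isomorphic objects of the stable category are stably equivalent modules. -/
theorem StablyEquivalent.of_iso (hCM : IsCohenMacaulayLocalRing R) {X Y : CM R}
    (e : (toStable R).obj X ≅ (toStable R).obj Y) : StablyEquivalent R X.obj Y.obj := by
  obtain ⟨f, hf⟩ := (toStable R).map_surjective e.hom
  obtain ⟨g, hg⟩ := (toStable R).map_surjective e.inv
  obtain ⟨P, hP, u, v, huv⟩ := factorsThroughProjective_of_map_eq (f := f ≫ g) (g := 𝟙 X)
    (by simp [hf, hg])
  obtain ⟨P', hP', u', v', huv'⟩ := factorsThroughProjective_of_map_eq (f := g ≫ f) (g := 𝟙 Y)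
    (by simp [hf, hg])
  have := Y.property.finite
  have := P.property.finite
  have := hP.projective hCM
  have := hP'.projective hCM
  rw [eq_sub_iff_add_eq'] at huv huv'
  exact .of_factorization f.hom.hom g.hom.hom u.hom.hom v.hom.hom u'.hom.hom v'.hom.hom
    (fun x => (LinearMap.congr_fun (congrArg (fun f => f.hom.hom) huv) x).symm)
    (fun x => (LinearMap.congr_fun (congrArg (fun f => f.hom.hom) huv') x).symm)

/-- Stable endomorphism rings are Dedekind finite: they are quotients of endomorphism rings of
finitely generated modules, which are Noetherian rings. -/
instance isDedekindFiniteMonoid_end_toStable_obj (X : CM R) :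
    IsDedekindFiniteMonoid (End ((toStable R).obj X)) := by
  have := X.property.finite
  have : IsNoetherianRing (Module.End R X.obj) := isNoetherian_of_tower R inferInstance
  let φ : Module.End R X.obj →+* End ((toStable R).obj X) :=
    { toFun f := (toStable R).map (ObjectProperty.homMk (ModuleCat.ofHom f))
      map_one' := (toStable R).map_id X
      map_mul' f g := (toStable R).map_comp (ObjectProperty.homMk (ModuleCat.ofHom g) : X ⟶ X)
        (ObjectProperty.homMk (ModuleCat.ofHom f))
      map_zero' := (toStable R).map_zero X X
      map_add' f g := (toStable R).map_add
        (f := (ObjectProperty.homMk (ModuleCat.ofHom f) : X ⟶ X))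
        (g := ObjectProperty.homMk (ModuleCat.ofHom g)) }
  have hφ : Function.Surjective φ := fun f => by
    obtain ⟨g, rfl⟩ := (toStable R).map_surjective f
    exact ⟨g.hom.hom, rfl⟩
  have := isNoetherianRing_of_surjective _ _ φ hφ
  infer_instance

instance isDedekindFiniteMonoid_end (X : CM R) : IsDedekindFiniteMonoid (End X) := by
  have := X.property.finite
  have : IsNoetherianRing (Module.End R X.obj) := isNoetherian_of_tower R inferInstance
  let φ : End X →* Module.End R X.obj :=
    { toFun f := f.hom.hom
      map_one' := rfl
      map_mul' _ _ := rfl }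
  exact .of_injective φ fun f g h => ObjectProperty.hom_ext _ (ModuleCat.hom_ext h)

/-- A split epimorphism between isomorphic objects is an isomorphism if the endomorphisms are
Dedekind finite. -/
theorem isIso_of_comp_eq_id {C : Type*} [Category* C] {A B : C} [IsDedekindFiniteMonoid (End B)]
    (e : A ≅ B) {s : B ⟶ A} {p : A ⟶ B} (h : s ≫ p = 𝟙 B) : IsIso p := by
  have h1 : End.of (e.inv ≫ p) * End.of (s ≫ e.hom) = 1 := by
    simp [End.mul_def, h, End.one_def]
  have h2 := mul_eq_one_comm.1 h1
  rw [End.mul_def, End.one_def] at h2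
  refine ⟨s, ?_, h⟩
  rw [← cancel_epi e.inv, ← cancel_mono e.hom]
  simpa using h2

end Stable

/-! ### Morphisms of short exact sequences and extension classes -/

section Extensions

variable {C : Type*} [Category* C] [Abelian C] [HasExt.{v} C] {S T : ShortComplex C}

theorem exists_comp_g_eq_of_comp_extClass (hS : S.ShortExact) {W : C} {h : W ⟶ S.X₃}
    (hh : (Abelian.Ext.mk₀ h).comp hS.extClass (zero_add 1) = 0) : ∃ k, k ≫ S.g = h := by
  obtain ⟨x, hx⟩ := Abelian.Ext.covariant_sequence_exact₃ _ hS _ rfl hh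
  obtain ⟨k, rfl⟩ := (Abelian.Ext.mk₀_bijective _ _).2 x
  rw [Abelian.Ext.mk₀_comp_mk₀] at hx
  exact ⟨k, (Abelian.Ext.mk₀_bijective _ _).1 hx⟩

theorem exists_f_comp_eq_of_extClass_comp (hS : S.ShortExact) {N : C} {φ : S.X₁ ⟶ N}
    (hφ : hS.extClass.comp (Abelian.Ext.mk₀ φ) (add_zero 1) = 0) : ∃ ψ, S.f ≫ ψ = φ := by
  obtain ⟨x, hx⟩ := Abelian.Ext.contravariant_sequence_exact₁ hS _ _ (add_zero 1) hφ
  obtain ⟨k, rfl⟩ := (Abelian.Ext.mk₀_bijective _ _).2 x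
  rw [Abelian.Ext.mk₀_comp_mk₀] at hx
  exact ⟨k, (Abelian.Ext.mk₀_bijective _ _).1 hx⟩

/-- Let `F : S ⟶ T` be a morphism of short exact sequences such that `F.τ₃` has the right inverse
`h` up to a map that lifts along `T.g`. Then pulling `T` back along `h ≫ F.τ₃` does not change its
extension class, because liftable maps kill it. -/
theorem mk₀_comp_mk₀_comp_extClass (hT : T.ShortExact) (F : S ⟶ T) {h : T.X₃ ⟶ S.X₃}
    {w : T.X₃ ⟶ T.X₂} (hw : h ≫ F.τ₃ = 𝟙 _ + w ≫ T.g) :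
    (Abelian.Ext.mk₀ h).comp ((Abelian.Ext.mk₀ F.τ₃).comp hT.extClass (zero_add 1)) (zero_add 1) =
      hT.extClass := by
  rw [Abelian.Ext.mk₀_comp_mk₀_assoc, hw, Abelian.Ext.mk₀_add, Abelian.Ext.add_comp,
    Abelian.Ext.mk₀_id_comp, ← Abelian.Ext.mk₀_comp_mk₀_assoc, hT.comp_extClass,
    Abelian.Ext.comp_zero, add_zero]

/-- If `F.τ₁ ≫ φ` extends along `S.f`, then `φ` extends along `T.f`: the pushout of `S` along
`F.τ₁ ≫ φ`, which splits, is the pullback along `F.τ₃` of the pushout of `T` along `φ`, and pulling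
it back further along `h` recovers that pushout. -/
theorem exists_f_comp_eq_of_exists_f_comp_eq (hS : S.ShortExact) (hT : T.ShortExact) (F : S ⟶ T)
    {h : T.X₃ ⟶ S.X₃} {w : T.X₃ ⟶ T.X₂} (hw : h ≫ F.τ₃ = 𝟙 _ + w ≫ T.g) {N : C} {φ : T.X₁ ⟶ N}
    (hφ : ∃ ψ, S.f ≫ ψ = F.τ₁ ≫ φ) : ∃ ψ, T.f ≫ ψ = φ := by
  obtain ⟨ψ, hψ⟩ := hφ
  refine exists_f_comp_eq_of_extClass_comp hT ?_
  rw [← mk₀_comp_mk₀_comp_extClass hT F hw, ← ShortComplex.ShortExact.extClass_naturality hS hT F,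
    Abelian.Ext.comp_assoc_of_third_deg_zero, Abelian.Ext.comp_assoc_of_third_deg_zero,
    Abelian.Ext.mk₀_comp_mk₀, ← hψ,
    ← Abelian.Ext.mk₀_comp_mk₀, hS.extClass_comp_assoc, Abelian.Ext.comp_zero]

/-- If `φ` is a right inverse of `F.τ₁` up to a map that extends along `S.f`, then the pullback of
`S` along `h` has the class of the pushout of `T` along `φ`. The latter is killed by pulling back
along `T.g`, so `T.g ≫ h` lifts along `S.g`. -/
theorem exists_comp_g_eq_comp (hS : S.ShortExact) (hT : T.ShortExact) (F : S ⟶ T)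
    {h : T.X₃ ⟶ S.X₃} {w : T.X₃ ⟶ T.X₂} (hw : h ≫ F.τ₃ = 𝟙 _ + w ≫ T.g)
    {φ : T.X₁ ⟶ S.X₁} {e : S.X₂ ⟶ S.X₁} (hφ : F.τ₁ ≫ φ + S.f ≫ e = 𝟙 _) :
    ∃ k : T.X₂ ⟶ S.X₂, k ≫ S.g = T.g ≫ h := by
  refine exists_comp_g_eq_of_comp_extClass hS ?_
  have h1 : hS.extClass = (hS.extClass.comp (Abelian.Ext.mk₀ F.τ₁) (add_zero 1)).comp
      (Abelian.Ext.mk₀ φ) (add_zero 1) := by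
    conv_lhs => rw [← Abelian.Ext.comp_mk₀_id hS.extClass, ← hφ]
    rw [Abelian.Ext.mk₀_add, Abelian.Ext.comp_add, ← Abelian.Ext.mk₀_comp_mk₀ S.f,
      hS.extClass_comp_assoc, add_zero, Abelian.Ext.comp_assoc_of_third_deg_zero,
      Abelian.Ext.mk₀_comp_mk₀]
  rw [h1, hS.extClass_naturality hT F, ← Abelian.Ext.mk₀_comp_mk₀_assoc,
    ← Abelian.Ext.comp_assoc_of_third_deg_zero, mk₀_comp_mk₀_comp_extClass hT F hw,
    ← Abelian.Ext.comp_assoc_of_third_deg_zero, hT.comp_extClass, Abelian.Ext.zero_comp]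

end Extensions

/-! ### Comparison of extension defects -/

section Counting

variable {R : Type u} [CommRing R]

theorem surjective_of_injective_of_length_eq {M N : Type*} [AddCommGroup M] [Module R M]
    [AddCommGroup N] [Module R N] (hN : IsFiniteLength R N)
    {f : M →ₗ[R] N} (hf : Function.Injective f) (h : Module.length R M = Module.length R N) :
    Function.Surjective f := by
  have h1 := Module.length_eq_add_of_exact f (LinearMap.range f).mkQ hf
    (Submodule.mkQ_surjective _) (LinearMap.exact_map_mkQ_range f)
  rw [← h] at h1
  have h2 : Module.length R M ≠ ⊤ := h ▸ Module.length_ne_top_iff.2 hN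
  have h3 := ENat.add_right_injective_of_ne_top h2 ((add_zero _).trans h1)
  rw [eq_comm, Module.length_eq_zero_iff, Submodule.Quotient.subsingleton_iff] at h3
  exact LinearMap.range_eq_top.1 h3

variable [IsLocalRing R] [IsNoetherianRing R] {S T : ShortComplex (ModuleCat.{u} R)}

/-- A morphism `F : S ⟶ T` as in `exists_f_comp_eq_of_exists_f_comp_eq` induces injections between
the extension defects of `T` and `S`. If the defects have the same length for all coefficient
modules of finite length, these injections are bijective, so the reduction of the identity of `S.X₁`
modulo each power of the maximal ideal factors through `S.X₁ ⟶ T.X₁ × S.X₂`; hence so does the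
identity itself. -/
theorem exists_retraction_of_length_extensionDefect_eq (hS : S.ShortExact) (hT : T.ShortExact)
    [Module.Finite R S.X₁] [Module.Finite R S.X₂] [Module.Finite R T.X₁]
    (hlen : ∀ (N : Type u) [AddCommGroup N] [Module R N], IsFiniteLength R N →
      Module.length R (ExtensionDefect T.f.hom N) = Module.length R (ExtensionDefect S.f.hom N))
    (F : S ⟶ T) {h : T.X₃ ⟶ S.X₃} {w : T.X₃ ⟶ T.X₂} (hw : h ≫ F.τ₃ = 𝟙 _ + w ≫ T.g) :
    ∃ (φ : T.X₁ ⟶ S.X₁) (e : S.X₂ ⟶ S.X₁), F.τ₁ ≫ φ + S.f ≫ e = 𝟙 _ := by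
  obtain ⟨k, hk⟩ := exists_comp_eq_of_forall_pow (F.τ₁.hom.prod S.f.hom) LinearMap.id fun n => by
    let N := S.X₁ ⧸ (IsLocalRing.maximalIdeal R ^ n • (⊤ : Submodule R S.X₁))
    have hN : IsFiniteLength R N := isFiniteLength_quotient_pow_smul_top S.X₁ n
    have hle : LinearMap.range (LinearMap.lcomp R N T.f.hom) ≤
        (LinearMap.range (LinearMap.lcomp R N S.f.hom)).comap (LinearMap.lcomp R N F.τ₁.hom) := by
      rintro _ ⟨ψ, rfl⟩
      refine ⟨ψ ∘ₗ F.τ₂.hom, ?_⟩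
      have := congrArg ModuleCat.Hom.hom F.comm₁₂
      ext x
      exact congrArg ψ (LinearMap.congr_fun this x).symm
    have hinj : Function.Injective (Submodule.mapQ _ _ _ hle) := by
      rw [← LinearMap.ker_eq_bot, Submodule.eq_bot_iff]
      intro x hx
      obtain ⟨φ, rfl⟩ := Submodule.mkQ_surjective _ x
      rw [LinearMap.mem_ker, Submodule.mkQ_apply, Submodule.mapQ_apply,
        Submodule.Quotient.mk_eq_zero] at hx
      obtain ⟨ψ, hψ⟩ := hx
      obtain ⟨ψ', hψ'⟩ := exists_f_comp_eq_of_exists_f_comp_eq hS hT F hw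
        (φ := ModuleCat.ofHom (Y := N) φ) ⟨ModuleCat.ofHom ψ, ModuleCat.hom_ext hψ⟩
      rw [Submodule.mkQ_apply, Submodule.Quotient.mk_eq_zero]
      exact ⟨ψ'.hom, congrArg ModuleCat.Hom.hom hψ'⟩
    have hfin : IsFiniteLength R (ExtensionDefect S.f.hom N) :=
      (isFiniteLength_linearMap S.X₁ N hN).of_surjective (Submodule.mkQ_surjective _)
    obtain ⟨x, hx⟩ := surjective_of_injective_of_length_eq hfin hinj (hlen N hN)
      (Submodule.Quotient.mk (Submodule.mkQ _))
    obtain ⟨φ, rfl⟩ := Submodule.mkQ_surjective _ x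
    rw [Submodule.mkQ_apply, Submodule.mapQ_apply, eq_comm, Submodule.Quotient.eq] at hx
    obtain ⟨ψ, hψ⟩ := hx
    refine ⟨φ.coprod ψ, LinearMap.ext fun x => ?_⟩
    have := LinearMap.congr_fun hψ x
    simp only [LinearMap.lcomp_apply, LinearMap.sub_apply] at this
    simp [this]
  refine ⟨ModuleCat.ofHom (k ∘ₗ LinearMap.inl R _ _), ModuleCat.ofHom (k ∘ₗ LinearMap.inr R _ _),
    ModuleCat.hom_ext (LinearMap.ext fun x => ?_)⟩
  have := LinearMap.congr_fun hk x
  simpa [← map_add] using this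

/-- A map between finitely generated modules is a split injection as soon as all maps from its
source to modules of finite length extend along it. -/
theorem exists_leftInverse_of_subsingleton_extensionDefect {X Y : Type u}
    [AddCommGroup X] [Module R X] [AddCommGroup Y] [Module R Y] [Module.Finite R X]
    [Module.Finite R Y] (f : X →ₗ[R] Y)
    (h : ∀ (N : Type u) [AddCommGroup N] [Module R N], IsFiniteLength R N →
      Subsingleton (ExtensionDefect f N)) :
    ∃ r : Y →ₗ[R] X, r ∘ₗ f = LinearMap.id := by
  refine exists_comp_eq_of_forall_pow f LinearMap.id fun n => ?_
  have := h _ (isFiniteLength_quotient_pow_smul_top X n)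
  rw [Submodule.Quotient.subsingleton_iff, LinearMap.range_eq_top] at this
  exact this _

end Counting

/-! ### Split sequences -/

section SplitSequences

variable {C : Type*} [Category* C] [Preadditive C]

theorem nonempty_iso_of_splitting {S T : ShortComplex C} (s : S.Splitting) (t : T.Splitting)
    (e₁ : S.X₁ ≅ T.X₁) (e₃ : S.X₃ ≅ T.X₃) : Nonempty (S ≅ T) := by
  have key {S T : ShortComplex C} (s : S.Splitting) (t : T.Splitting)
      (e₁ : S.X₁ ≅ T.X₁) (e₃ : S.X₃ ≅ T.X₃) :
      (s.r ≫ e₁.hom ≫ T.f + S.g ≫ e₃.hom ≫ t.s) ≫ (t.r ≫ e₁.inv ≫ S.f + T.g ≫ e₃.inv ≫ s.s) =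
        𝟙 _ := by
    simp [Preadditive.add_comp, Preadditive.comp_add, reassoc_of% t.f_r, reassoc_of% t.s_g,
      reassoc_of% t.s_r, s.id]
  let e₂ : S.X₂ ≅ T.X₂ :=
    { hom := s.r ≫ e₁.hom ≫ T.f + S.g ≫ e₃.hom ≫ t.s
      inv := t.r ≫ e₁.inv ≫ S.f + T.g ≫ e₃.inv ≫ s.s
      hom_inv_id := key s t e₁ e₃
      inv_hom_id := key t s e₁.symm e₃.symm }
  exact ⟨ShortComplex.isoMk e₁ e₂ e₃ (by simp [e₂, reassoc_of% s.f_r])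
    (by simp [e₂, t.s_g])⟩

theorem isSplitEpi_g {S : ShortComplex C} (s : S.Splitting) : IsSplitEpi S.g :=
  ⟨⟨⟨s.s, s.s_g⟩⟩⟩

end SplitSequences

/-! ### Almost split maps -/

section AlmostSplit

variable {C : Type*} [Category* C]

theorem isIso_of_isSplitMono {B : C} [IsDedekindFiniteMonoid (End B)] {p : B ⟶ B}
    (hp : IsSplitMono p) : IsIso p := by
  have := isIso_of_comp_eq_id (Iso.refl B) (IsSplitMono.id p)
  rw [IsIso.eq_inv_of_inv_hom_id (IsSplitMono.id p)]
  infer_instance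

variable [Preadditive C]

/-- A left almost split map is left minimal: an endomorphism of its source which differs from the
identity by a map that extends along it is invertible. -/
theorem IsLeftAlmostSplit.isIso_of_comp_eq_id_sub {A B : C} [IsDedekindFiniteMonoid (End A)]
    {a : A ⟶ B} (ha : IsLeftAlmostSplit a) {θ : A ⟶ A} {t : B ⟶ A} (ht : a ≫ t = 𝟙 A - θ) :
    IsIso θ := by
  refine isIso_of_isSplitMono (by_contra fun hθ => ?_)
  obtain ⟨l, hl⟩ := ha.2 θ hθ
  refine ha.1 ⟨⟨⟨t + l, ?_⟩⟩⟩
  rw [Preadditive.comp_add, ht, hl, sub_add_cancel]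

theorem IsLeftAlmostSplit.of_iso {S T : ShortComplex C} (h : IsLeftAlmostSplit S.f) (e : S ≅ T) :
    IsLeftAlmostSplit T.f := by
  refine ⟨fun ⟨⟨r⟩⟩ => h.1 ⟨⟨⟨e.hom.τ₂ ≫ r.retraction ≫ e.inv.τ₁, ?_⟩⟩⟩, fun X g hg => ?_⟩
  · rw [← e.hom.comm₁₂_assoc, r.id_assoc]
    exact congrArg ShortComplex.Hom.τ₁ e.hom_inv_id
  · have h1 : e.inv.τ₁ ≫ e.hom.τ₁ = 𝟙 _ := congrArg ShortComplex.Hom.τ₁ e.inv_hom_id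
    have hg' : ¬ IsSplitMono (e.hom.τ₁ ≫ g) := fun _ => hg <| by
      rw [← Category.id_comp g, ← h1, Category.assoc]
      infer_instance
    obtain ⟨k, hk⟩ := h.2 _ hg'
    exact ⟨e.inv.τ₂ ≫ k, by rw [← e.inv.comm₁₂_assoc, hk, reassoc_of% h1]⟩

theorem IsRightAlmostSplit.of_iso {S T : ShortComplex C} (h : IsRightAlmostSplit S.g) (e : S ≅ T) :
    IsRightAlmostSplit T.g := by
  refine ⟨fun ⟨⟨s⟩⟩ => h.1 ⟨⟨⟨e.hom.τ₃ ≫ s.section_ ≫ e.inv.τ₂, ?_⟩⟩⟩, fun X g hg => ?_⟩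
  · rw [Category.assoc, Category.assoc, e.inv.comm₂₃, s.id_assoc]
    exact congrArg ShortComplex.Hom.τ₃ e.hom_inv_id
  · have h1 : e.inv.τ₃ ≫ e.hom.τ₃ = 𝟙 _ := congrArg ShortComplex.Hom.τ₃ e.inv_hom_id
    have hg' : ¬ IsSplitEpi (g ≫ e.inv.τ₃) := fun _ => hg <| by
      rw [← Category.comp_id g, ← h1, ← Category.assoc]
      infer_instance
    obtain ⟨k, hk⟩ := h.2 _ hg'
    exact ⟨k ≫ e.hom.τ₂, by rw [Category.assoc, e.hom.comm₂₃, reassoc_of% hk, h1, Category.comp_id]⟩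

end AlmostSplit

/-! ### Exact sequences of maximal Cohen-Macaulay modules -/

section MaximalCohenMacaulay

variable {R : Type u} [CommRing R] [IsLocalRing R]

theorem CMExact.exists_comp_f_eq {T : ShortComplex (CM R)} (hT : CMExact T) {W : CM R}
    {k : W ⟶ T.X₂} (hk : k ≫ T.g = 0) : ∃ x, x ≫ T.f = k := by
  have := hT.mono_f
  have h0 : k.hom ≫ (T.map (isMCM R).ι).g = 0 := congrArg (isMCM R).ι.map hk
  exact ⟨ObjectProperty.homMk (hT.exact.lift k.hom h0),
    ObjectProperty.hom_ext _ (hT.exact.lift_f _ h0)⟩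

theorem CMExact.exists_hom {S T : ShortComplex (CM R)} (hT : CMExact T) (k : S.X₂ ⟶ T.X₂)
    (h : S.X₃ ⟶ T.X₃) (hk : k ≫ T.g = S.g ≫ h) : ∃ F : S ⟶ T, F.τ₂ = k ∧ F.τ₃ = h := by
  obtain ⟨x, hx⟩ := hT.exists_comp_f_eq (k := S.f ≫ k)
    (by rw [Category.assoc, hk, S.zero_assoc, zero_comp])
  exact ⟨{ τ₁ := x, τ₂ := k, τ₃ := h, comm₁₂ := hx, comm₂₃ := hk }, rfl, rfl⟩

theorem CMExact.nonempty_splitting {S : ShortComplex (CM R)} (hS : CMExact S)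
    (h : IsSplitEpi S.g) : Nonempty S.Splitting := by
  have := hS.mono_f
  let s : (S.map (isMCM R).ι).Splitting := .ofExactOfSection _ hS.exact (section_ S.g).hom
    (congrArg (isMCM R).ι.map (IsSplitEpi.id S.g)) this
  exact ⟨{ r := ObjectProperty.homMk s.r
           s := ObjectProperty.homMk s.s
           f_r := ObjectProperty.hom_ext _ s.f_r
           s_g := ObjectProperty.hom_ext _ s.s_g
           id := ObjectProperty.hom_ext _ s.id }⟩

variable [IsNoetherianRing R]

/-- The extension defects of two exact sequences in `CM R` with stably equivalent terms have the
same length. -/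
theorem CMExact.length_extensionDefect_eq {S T : ShortComplex (CM R)} (hS : CMExact S)
    (hT : CMExact T) (h₁ : StablyEquivalent R S.X₁.obj T.X₁.obj)
    (h₂ : StablyEquivalent R S.X₂.obj T.X₂.obj) (h₃ : StablyEquivalent R S.X₃.obj T.X₃.obj)
    {N : Type u} [AddCommGroup N] [Module R N] (hN : IsFiniteLength R N) :
    Module.length R (ExtensionDefect S.f.hom.hom N) =
      Module.length R (ExtensionDefect T.f.hom.hom N) := by
  have := S.X₁.property.finite
  have := S.X₂.property.finite
  have := S.X₃.property.finite
  have := T.X₁.property.finite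
  have := T.X₂.property.finite
  have := T.X₃.property.finite
  have := hS.mono_f
  have := hS.epi_g
  have := hT.mono_f
  have := hT.epi_g
  exact CMRep.length_extensionDefect_eq (X := S.X₁.obj) (Y := S.X₂.obj) (Z := S.X₃.obj)
    (X' := T.X₁.obj) (Y' := T.X₂.obj) (Z' := T.X₃.obj) hN
    ((ModuleCat.mono_iff_injective (S.map (isMCM R).ι).f).1 inferInstance)
    ((ShortComplex.ShortExact.moduleCat_exact_iff_function_exact _).1 hS.exact)
    ((ModuleCat.epi_iff_surjective (S.map (isMCM R).ι).g).1 inferInstance)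
    ((ModuleCat.mono_iff_injective (T.map (isMCM R).ι).f).1 inferInstance)
    ((ShortComplex.ShortExact.moduleCat_exact_iff_function_exact _).1 hT.exact)
    ((ModuleCat.epi_iff_surjective (T.map (isMCM R).ι).g).1 inferInstance) h₁ h₂ h₃

/-- A form of Miyata's theorem: an exact sequence in `CM R` splits if its terms are stably
equivalent to those of a split one. -/
theorem CMExact.isSplitEpi_g_of_stablyEquivalent {S T : ShortComplex (CM R)} (hS : CMExact S)
    (hT : CMExact T) (h₁ : StablyEquivalent R S.X₁.obj T.X₁.obj)
    (h₂ : StablyEquivalent R S.X₂.obj T.X₂.obj) (h₃ : StablyEquivalent R S.X₃.obj T.X₃.obj)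
    (h : IsSplitEpi T.g) : IsSplitEpi S.g := by
  have := S.X₁.property.finite
  have := S.X₂.property.finite
  obtain ⟨t⟩ := hT.nonempty_splitting h
  obtain ⟨r, hr⟩ := exists_leftInverse_of_subsingleton_extensionDefect S.f.hom.hom
    fun N _ _ hN => by
    rw [← Module.length_eq_zero_iff (R := R), hS.length_extensionDefect_eq hT h₁ h₂ h₃ hN,
      Module.length_eq_zero_iff, Submodule.Quotient.subsingleton_iff, LinearMap.range_eq_top]
    intro φ
    refine ⟨φ ∘ₗ t.r.hom.hom, LinearMap.ext fun x => congrArg φ ?_⟩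
    exact LinearMap.congr_fun (congrArg (fun f => f.hom.hom) t.f_r) x
  have := hS.epi_g
  let s : (S.map (isMCM R).ι).Splitting := .ofExactOfRetraction _ hS.exact (ModuleCat.ofHom r)
    (ModuleCat.hom_ext hr) inferInstance
  exact ⟨⟨⟨ObjectProperty.homMk s.s, ObjectProperty.hom_ext _ s.s_g⟩⟩⟩

/-- Let `F : S ⟶ T` be a morphism between exact sequences with stably equivalent terms whose third
component has a right inverse `h` up to maps that lift along `T.g`. Then the first component also
has a right inverse, up to maps that extend along `T.f`, and `h` is covered by a map of the middle
terms. -/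
theorem CMExact.exists_of_hom {S T : ShortComplex (CM R)} (hS : CMExact S)
    (hT : CMExact T) (h₁ : StablyEquivalent R S.X₁.obj T.X₁.obj)
    (h₂ : StablyEquivalent R S.X₂.obj T.X₂.obj) (h₃ : StablyEquivalent R S.X₃.obj T.X₃.obj)
    (F : S ⟶ T) {h : T.X₃ ⟶ S.X₃} {w : T.X₃ ⟶ T.X₂} (hw : h ≫ F.τ₃ = 𝟙 _ + w ≫ T.g) :
    ∃ (φ : T.X₁ ⟶ S.X₁) (t : T.X₂ ⟶ T.X₁) (k : T.X₂ ⟶ S.X₂),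
      T.f ≫ t = 𝟙 _ - φ ≫ F.τ₁ ∧ k ≫ S.g = T.g ≫ h := by
  let F' : S.map (isMCM R).ι ⟶ T.map (isMCM R).ι := (isMCM R).ι.mapShortComplex.map F
  have hw' : h.hom ≫ F'.τ₃ = 𝟙 _ + w.hom ≫ (T.map (isMCM R).ι).g :=
    congrArg (isMCM R).ι.map hw
  have : Module.Finite R (S.map (isMCM R).ι).X₁ := S.X₁.property.finite
  have : Module.Finite R (S.map (isMCM R).ι).X₂ := S.X₂.property.finite
  have : Module.Finite R (T.map (isMCM R).ι).X₁ := T.X₁.property.finite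
  obtain ⟨φ, e, hφ⟩ := exists_retraction_of_length_extensionDefect_eq hS hT
    (fun N _ _ hN => (hS.length_extensionDefect_eq hT h₁ h₂ h₃ hN).symm) F' hw'
  obtain ⟨k, hk⟩ := exists_comp_g_eq_comp hS hT F' hw' hφ
  obtain ⟨t, ht⟩ := exists_f_comp_eq_of_exists_f_comp_eq hS hT F' hw' (φ := 𝟙 _ - φ ≫ F'.τ₁)
    ⟨e ≫ F'.τ₁, by
      rw [← Category.assoc, eq_sub_of_add_eq' hφ, Preadditive.sub_comp, Preadditive.comp_sub]
      simp⟩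
  exact ⟨ObjectProperty.homMk φ, ObjectProperty.homMk t, ObjectProperty.homMk k,
    ObjectProperty.hom_ext _ ht, ObjectProperty.hom_ext _ hk⟩

/-- Lifting along the second map of an exact sequence can be tested in the stable category, since
maps that factor through a projective object always lift. The dual statement fails: a
projective object need not be injective in `CM R`. -/
theorem exists_comp_eq_of_map_comp_eq {S : ShortComplex (CM R)} (hS : CMExact S) {W : CM R}
    {h : W ⟶ S.X₃} (hh : ∃ k, k ≫ (toStable R).map S.g = (toStable R).map h) :
    ∃ k, k ≫ S.g = h := by
  obtain ⟨k, hk⟩ := hh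
  obtain ⟨k, rfl⟩ := (toStable R).map_surjective k
  rw [← Functor.map_comp] at hk
  obtain ⟨P, hP, u, v, huv⟩ := factorsThroughProjective_of_map_eq hk
  obtain ⟨v', rfl⟩ := hP S hS v
  refine ⟨k - u ≫ v', ?_⟩
  rw [Preadditive.sub_comp, Category.assoc, huv]
  abel

theorem isSplitEpi_g_of_isSplitEpi_map {S : ShortComplex (CM R)} (hS : CMExact S)
    (h : IsSplitEpi ((toStable R).map S.g)) : IsSplitEpi S.g := by
  obtain ⟨s, hs⟩ := exists_comp_eq_of_map_comp_eq hS (h := 𝟙 S.X₃)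
    ⟨section_ ((toStable R).map S.g), by simp⟩
  exact ⟨⟨⟨s, hs⟩⟩⟩

theorem determinedByTerms_of_isSplitExact {S : ShortComplex (CM R)}
    (hS : IsSplitExact CMExact S) : DeterminedByTerms CMExact S := by
  intro a b w hT
  obtain ⟨s⟩ := hS.splitting
  have hrefl (X : CM R) : StablyEquivalent R X.obj X.obj := ⟨0, 0, ⟨.refl _ _⟩⟩
  obtain ⟨t⟩ := hT.nonempty_splitting
    (hT.isSplitEpi_g_of_stablyEquivalent hS.exact (hrefl _) (hrefl _) (hrefl _) (isSplitEpi_g s))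
  exact nonempty_iso_of_splitting t s (Iso.refl _) (Iso.refl _)

theorem determinedByTerms_of_isAlmostSplit {T : ShortComplex (CM R)}
    (hT : IsAlmostSplit CMExact T) : DeterminedByTerms CMExact T := by
  intro a b w hS
  have hrefl (X : CM R) : StablyEquivalent R X.obj X.obj := ⟨0, 0, ⟨.refl _ _⟩⟩
  obtain ⟨k, hk⟩ := hT.right.2 b fun hb => hT.right.1
    (hT.exact.isSplitEpi_g_of_stablyEquivalent hS (hrefl _) (hrefl _) (hrefl _) hb)
  obtain ⟨F, -, hF⟩ := hT.exact.exists_hom (S := .mk a b w) k (𝟙 _)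
    (by rw [hk, Category.comp_id])
  obtain ⟨φ, t, -, ht, -⟩ := CMExact.exists_of_hom hS hT.exact (hrefl _) (hrefl _) (hrefl _) F
    (h := 𝟙 _) (w := 0) (by rw [hF]; simp)
  have hφ := hT.left.isIso_of_comp_eq_id_sub ht
  have h₁ : IsIso F.τ₁ := isIso_of_comp_eq_id (Iso.refl _) (s := inv (φ ≫ F.τ₁) ≫ φ) (by simp)
  have h₃ : IsIso F.τ₃ := by rw [hF]; exact IsIso.id _
  have h₂ : IsIso F.τ₂ := by
    rw [← ObjectProperty.isIso_hom_iff] at h₁ h₃ ⊢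
    exact ShortComplex.isIso₂_of_shortExact_of_isIso₁₃' ((isMCM R).ι.mapShortComplex.map F)
      hS hT.exact h₁ h₃
  have := ShortComplex.isIso_of_isIso F
  exact ⟨asIso F⟩

/-- The common part of the two assertions about the stable category. The sequence `T` is assumed to
be non-split, to be right almost split with respect to maps which are not stably split, and to be
left minimal up to stable isomorphism. The argument is that for almost split sequences of `CM R`,
with isomorphisms replaced by stable isomorphisms. -/
theorem nonempty_iso_map_toStable (hCM : IsCohenMacaulayLocalRing R) {T S : ShortComplex (CM R)}
    (hT : CMExact T) (hS : CMExact S) (hns : ¬ IsSplitEpi T.g)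
    (hright : ∀ ⦃W : CM R⦄ (h : W ⟶ T.X₃), ¬ IsSplitEpi ((toStable R).map h) → ∃ k, k ≫ T.g = h)
    (hleft : ∀ (θ : T.X₁ ⟶ T.X₁) (t : T.X₂ ⟶ T.X₁), T.f ≫ t = 𝟙 _ - θ →
      IsIso ((toStable R).map θ))
    (e₁ : (toStable R).obj S.X₁ ≅ (toStable R).obj T.X₁)
    (e₂ : (toStable R).obj S.X₂ ≅ (toStable R).obj T.X₂)
    (e₃ : (toStable R).obj S.X₃ ≅ (toStable R).obj T.X₃) :
    Nonempty (S.map (toStable R) ≅ T.map (toStable R)) := by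
  have s₁ := StablyEquivalent.of_iso hCM e₁
  have s₂ := StablyEquivalent.of_iso hCM e₂
  have s₃ := StablyEquivalent.of_iso hCM e₃
  obtain ⟨h₀, hh₀⟩ := (toStable R).map_surjective e₃.hom
  obtain ⟨h₁, hh₁⟩ := (toStable R).map_surjective e₃.inv
  obtain ⟨P, hP, u, v, huv⟩ := factorsThroughProjective_of_map_eq (f := h₁ ≫ h₀) (g := 𝟙 _)
    (by simp [hh₀, hh₁])
  obtain ⟨v, rfl⟩ := hP T hT v
  have hw : h₁ ≫ h₀ = 𝟙 _ + (u ≫ v) ≫ T.g := by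
    rw [Category.assoc, huv, add_sub_cancel]
  have hw₀ : (toStable R).map (u ≫ v) = 0 := by
    rw [← (toStable R).map_zero]
    exact map_eq_of_factorsThroughProjective ⟨P, hP, u, v, by rw [sub_zero]⟩
  obtain ⟨k, hk⟩ := hright (S.g ≫ h₀) fun h => hns <|
    hT.isSplitEpi_g_of_stablyEquivalent hS (.of_iso hCM e₁.symm) (.of_iso hCM e₂.symm)
      (.of_iso hCM e₃.symm) <| isSplitEpi_g_of_isSplitEpi_map hS <| by
        have : (toStable R).map S.g = (toStable R).map (S.g ≫ h₀) ≫ e₃.inv := by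
          simp [hh₀]
        rw [this]
        infer_instance
  obtain ⟨F, rfl, rfl⟩ := hT.exists_hom k h₀ hk
  obtain ⟨φ, t, k, ht, hk'⟩ := hS.exists_of_hom hT s₁ s₂ s₃ F hw
  have hφ := hleft _ t ht
  have i₃ : IsIso ((toStable R).map F.τ₃) := by rw [hh₀]; infer_instance
  rw [Functor.map_comp] at hφ
  let j := inv ((toStable R).map φ ≫ (toStable R).map F.τ₁)
  have hj : j ≫ (toStable R).map φ ≫ (toStable R).map F.τ₁ = 𝟙 _ := IsIso.inv_hom_id _
  have i₁ : IsIso ((toStable R).map F.τ₁) :=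
    isIso_of_comp_eq_id e₁ (s := j ≫ (toStable R).map φ) (by rw [Category.assoc, hj])
  -- The endomorphism `k ≫ F.τ₂` of `T.X₂` lies over `1 + u ≫ v ≫ T.g`, so it differs from
  -- `1 + T.g ≫ u ≫ v` by a map that factors through the kernel `T.f`.
  obtain ⟨x, hx⟩ : ∃ x, x ≫ T.f = k ≫ F.τ₂ - 𝟙 _ - T.g ≫ u ≫ v := by
    refine hT.exists_comp_f_eq ?_
    rw [Preadditive.sub_comp, Preadditive.sub_comp, Category.assoc, F.comm₂₃, reassoc_of% hk', hw,
      Preadditive.comp_add]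
    simp
  -- Stably `x ≫ T.f` is `k ≫ F.τ₂ - 1`. It factors through `F.τ₂` because `F.τ₁` has a stable
  -- section, so `k` can be corrected to a stable section of `F.τ₂`.
  have i₂ : IsIso ((toStable R).map F.τ₂) := by
    refine isIso_of_comp_eq_id e₂ (s := (toStable R).map k -
      (toStable R).map x ≫ j ≫ (toStable R).map φ ≫ (toStable R).map S.f) ?_
    have h1 := congrArg (toStable R).map hx
    have h2 := congrArg (toStable R).map F.comm₁₂
    simp only [Functor.map_comp, Functor.map_sub] at h1 h2
    rw [← Functor.map_comp _ u v, hw₀, comp_zero, sub_zero] at h1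
    rw [Preadditive.sub_comp]
    simp only [Category.assoc]
    rw [← h2, reassoc_of% hj, h1, sub_sub_cancel, CategoryTheory.Functor.map_id]
  let G : S.map (toStable R) ⟶ T.map (toStable R) := (toStable R).mapShortComplex.map F
  have : IsIso G.τ₁ := i₁
  have : IsIso G.τ₂ := i₂
  have : IsIso G.τ₃ := i₃
  have := ShortComplex.isIso_of_isIso G
  exact ⟨asIso G⟩

theorem determinedByTerms_toStable_of_isAlmostSplit (hCM : IsCohenMacaulayLocalRing R)
    {T : ShortComplex (CM R)} (hT : IsAlmostSplit CMExact T) :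
    DeterminedByTerms StableExact (T.map (toStable R)) := by
  rintro a b w ⟨S, hS, ⟨e⟩⟩
  obtain ⟨i⟩ := nonempty_iso_map_toStable hCM hT.exact hS hT.right.1
    (fun W h hh => hT.right.2 h fun _ => hh inferInstance)
    (fun θ t ht => have := hT.left.isIso_of_comp_eq_id_sub ht; inferInstance)
    (ShortComplex.π₁.mapIso e) (ShortComplex.π₂.mapIso e) (ShortComplex.π₃.mapIso e)
  exact ⟨e.symm ≪≫ i⟩

theorem stable_determinedByTerms_of_isSplitExact (hCM : IsCohenMacaulayLocalRing R)
    {S : ShortComplex (StableCM R)} (hS : IsSplitExact StableExact S) :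
    DeterminedByTerms StableExact S := by
  rintro a b w ⟨T', hT', ⟨e'⟩⟩
  obtain ⟨T, hT, ⟨e⟩⟩ := hS.exact
  obtain ⟨s⟩ := hS.splitting
  have hTg := isSplitEpi_g_of_isSplitEpi_map hT (isSplitEpi_g (s.ofIso e.symm))
  obtain ⟨t⟩ := hT'.nonempty_splitting <| hT'.isSplitEpi_g_of_stablyEquivalent hT
    (.of_iso hCM (ShortComplex.π₁.mapIso e' ≪≫ (ShortComplex.π₁.mapIso e).symm))
    (.of_iso hCM (ShortComplex.π₂.mapIso e' ≪≫ (ShortComplex.π₂.mapIso e).symm))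
    (.of_iso hCM (ShortComplex.π₃.mapIso e' ≪≫ (ShortComplex.π₃.mapIso e).symm)) hTg
  exact nonempty_iso_of_splitting ((t.map (toStable R)).ofIso e') s (Iso.refl _) (Iso.refl _)

theorem stable_determinedByTerms_of_isAlmostSplit (hCM : IsCohenMacaulayLocalRing R)
    {S : ShortComplex (StableCM R)} (hS : IsAlmostSplit StableExact S) :
    DeterminedByTerms StableExact S := by
  rintro a b w ⟨T', hT', ⟨e'⟩⟩
  obtain ⟨T, hT, ⟨e⟩⟩ := hS.exact
  have hl : IsLeftAlmostSplit ((toStable R).map T.f) := hS.left.of_iso e.symm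
  have hr : IsRightAlmostSplit ((toStable R).map T.g) := hS.right.of_iso e.symm
  obtain ⟨i⟩ := nonempty_iso_map_toStable hCM hT hT'
    (fun _ => hr.1 inferInstance)
    (fun W h hh => exists_comp_eq_of_map_comp_eq hT (hr.2 _ hh))
    (fun θ t ht => hl.isIso_of_comp_eq_id_sub (t := (toStable R).map t)
      (by rw [← Functor.map_comp, ht, Functor.map_sub, CategoryTheory.Functor.map_id]))
    (ShortComplex.π₁.mapIso e' ≪≫ (ShortComplex.π₁.mapIso e).symm)
    (ShortComplex.π₂.mapIso e' ≪≫ (ShortComplex.π₂.mapIso e).symm)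
    (ShortComplex.π₃.mapIso e' ≪≫ (ShortComplex.π₃.mapIso e).symm)
  exact ⟨e'.symm ≪≫ i ≪≫ e⟩

end MaximalCohenMacaulay

end CMRep

theorem theoremA2 (R : Type u) [CommRing R] [IsLocalRing R] [IsNoetherianRing R]
    [IsAdicComplete (IsLocalRing.maximalIdeal R) R]
    (hCM : CMRep.IsCohenMacaulayLocalRing R) (hiso : CMRep.IsIsolatedSingularity R) :
    -- split exact and almost split sequences in `CM R`
    (∀ S : ShortComplex (CMRep.CM R), CMRep.IsSplitExact CMRep.CMExact S →
      CMRep.DeterminedByTerms CMRep.CMExact S) ∧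
    (∀ S : ShortComplex (CMRep.CM R), CMRep.IsAlmostSplit CMRep.CMExact S →
      CMRep.DeterminedByTerms CMRep.CMExact S) ∧
    -- split exact and almost split sequences in the stable category
    (∀ S : ShortComplex (CMRep.StableCM R), CMRep.IsSplitExact CMRep.StableExact S →
      CMRep.DeterminedByTerms CMRep.StableExact S) ∧
    (∀ S : ShortComplex (CMRep.StableCM R), CMRep.IsAlmostSplit CMRep.StableExact S →
      CMRep.DeterminedByTerms CMRep.StableExact S) ∧
    -- images in the stable category of almost split sequences in `CM R`
    (∀ S : ShortComplex (CMRep.CM R), CMRep.IsAlmostSplit CMRep.CMExact S →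
      CMRep.DeterminedByTerms CMRep.StableExact (S.map (CMRep.toStable R))) :=
  ⟨fun _ hS => CMRep.determinedByTerms_of_isSplitExact hS,
    fun _ hS => CMRep.determinedByTerms_of_isAlmostSplit hS,
    fun _ hS => CMRep.stable_determinedByTerms_of_isSplitExact hCM hS,
    fun _ hS => CMRep.stable_determinedByTerms_of_isAlmostSplit hCM hS,
    fun _ hS => CMRep.determinedByTerms_toStable_of_isAlmostSplit hCM hS⟩
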